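/- Let $\mathrm{Nil}$ be the group of real matrices $\begin{pmatrix}1&x&z\\0&1&y\\0&0&1\end{pmatrix}$ with the left invariant Riemannian metric $dx^2+dy^2+(dz-x\,dy)^2$, and let $e_1=E_{12}$, $e_2=E_{23}$, $e_3=E_{13}$ (matrix units) be the corresponding orthonormal basis of its Lie algebra. Let $f:M\to\mathrm{Nil}$ be a $C^2$-immersed surface which is minimal (its mean curvature $H$ vanishes identically), and let $w=u+iv$ be a conformal parameter on an open subset of $M$, i.e. the induced metric is $e^{2\alpha}(du^2+dv^2)$ there. Put $\partial=\frac12(\partial_u-i\partial_v)$ and $\bar\partial=\frac12(\partial_u+i\partial_v)$. Let $\psi=(\psi_1,\psi_2)$ be a generating spinor of the surface in this parameter: a pair of continuous complex-valued functions such that $$f^{-1}\partial f=Z_1e_1+Z_2e_2+Z_3e_3,\qquad Z_1=\tfrac i2(\bar\psi_2^2+\psi_1^2),\quad Z_2=\tfrac12(\bar\psi_2^2-\psi_1^2),\quad Z_3=\psi_1\bar\psi_2 .$$ Then $\psi_1,\psi_2$ are (real) differentiable and satisfy $$\bar\partial\psi_1=\frac i4\left(|\psi_2|^2-|\psi_1|^2\right)\psi_2,\qquad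 \partial\psi_2=-\frac i4\left(|\psi_2|^2-|\psi_1|^2\right)\psi_1 .$$ -/

import Mathlib

open scoped Manifold ContDiff

/-! ### The group Nil with its left invariant metric -/

/-- The Heisenberg group `Nil`; the triple `(x, y, z)` stands for the upper unitriangular matrix
`!![1, x, z; 0, 1, y; 0, 0, 1]` (see `NilGroup.toMatrix`). -/
@[ext]
structure NilGroup where
  x : ℝ
  y : ℝ
  z : ℝ

namespace NilGroup

instance : Mul NilGroup := ⟨fun g h => ⟨g.x + h.x, g.y + h.y, g.z + h.z + g.x * h.y⟩⟩
instance : One NilGroup := ⟨⟨0, 0, 0⟩⟩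
instance : Inv NilGroup := ⟨fun g => ⟨-g.x, -g.y, -g.z + g.x * g.y⟩⟩

theorem mul_def (g h : NilGroup) :
    g * h = ⟨g.x + h.x, g.y + h.y, g.z + h.z + g.x * h.y⟩ := rfl

theorem one_def : (1 : NilGroup) = ⟨0, 0, 0⟩ := rfl

theorem inv_def (g : NilGroup) : g⁻¹ = ⟨-g.x, -g.y, -g.z + g.x * g.y⟩ := rfl

instance : Group NilGroup :=
  Group.ofLeftAxioms
    (fun a b c => by ext <;> simp only [mul_def] <;> ring)
    (fun a => by ext <;> simp only [mul_def, one_def] <;> ring)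
    (fun a => by ext <;> simp only [mul_def, one_def, inv_def] <;> ring)

/-- The matrix realization of `Nil`, with the usual matrix multiplication. -/
def toMatrix : NilGroup →* Matrix (Fin 3) (Fin 3) ℝ where
  toFun g := !![1, g.x, g.z; 0, 1, g.y; 0, 0, 1]
  map_one' := by
    ext i j
    fin_cases i <;> fin_cases j <;> simp [one_def]
  map_mul' g h := by
    ext i j
    fin_cases i <;> fin_cases j <;>
      simp [mul_def, Matrix.mul_apply, Fin.sum_univ_three] <;> ring

/-- The basis `e₁, e₂, e₃` of the Lie algebra of `Nil` (indexed by `0, 1, 2`), regarded as complex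
matrices. -/
noncomputable def lieBasis : Fin 3 → Matrix (Fin 3) (Fin 3) ℂ :=
  ![!![0, 1, 0; 0, 0, 0; 0, 0, 0],
    !![0, 0, 0; 0, 0, 1; 0, 0, 0],
    !![0, 0, 1; 0, 0, 0; 0, 0, 0]]

/-- The global chart `(x, y, z)` of `Nil`. -/
def coords (g : NilGroup) : Fin 3 → ℝ := ![g.x, g.y, g.z]

/-- The Riemannian metric `dx² + dy² + (dz - x dy)²`, evaluated at the point with coordinates `p`
on tangent vectors with components `u`, `v`. -/
def metric (p u v : Fin 3 → ℝ) : ℝ :=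
  u 0 * v 0 + u 1 * v 1 + (u 2 - p 0 * u 1) * (v 2 - p 0 * v 1)

/-- The components `g_{ij}` of the metric in the chart `(x, y, z)`. -/
def gram (p : Fin 3 → ℝ) : Matrix (Fin 3) (Fin 3) ℝ :=
  Matrix.of fun i j => metric p (Pi.single i 1) (Pi.single j 1)

/-- The partial derivative `∂_i g_{jl}` at `p`. -/
noncomputable def gramDeriv (p : Fin 3 → ℝ) (i j l : Fin 3) : ℝ :=
  fderiv ℝ (fun q => gram q j l) p (Pi.single i 1)

/-- The Christoffel symbols `Γ^k_{ij}` of the Levi-Civita connection in the chart `(x, y, z)`. -/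
noncomputable def christoffel (p : Fin 3 → ℝ) (k i j : Fin 3) : ℝ :=
  1 / 2 * ∑ l, (gram p)⁻¹ k l * (gramDeriv p i j l + gramDeriv p j i l - gramDeriv p l i j)

/-! ### Geometry of a local parametrization

`F : ℂ → (Fin 3 → ℝ)` gives the coordinates in `Nil` of a map of the parameter `w = u + iv`. -/

/-- The two coordinate directions of the parameter plane. -/
noncomputable def dir : Fin 2 → ℂ := ![1, Complex.I]

/-- The coordinate tangent vectors: `∂F/∂u` for `a = 0` and `∂F/∂v` for `a = 1`. -/
noncomputable def tangent (F : ℂ → Fin 3 → ℝ) (a : Fin 2) (w : ℂ) : Fin 3 → ℝ :=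
  fderiv ℝ F w (dir a)

/-- The covariant derivative `∇_{∂_a F} ∂_b F` in `Nil`. -/
noncomputable def covDeriv (F : ℂ → Fin 3 → ℝ) (a b : Fin 2) (w : ℂ) : Fin 3 → ℝ := fun k =>
  fderiv ℝ (tangent F b) w (dir a) k +
    ∑ i, ∑ j, christoffel (F w) k i j * tangent F a w i * tangent F b w j

/-- The first fundamental form. -/
noncomputable def firstForm (F : ℂ → Fin 3 → ℝ) (w : ℂ) : Matrix (Fin 2) (Fin 2) ℝ :=
  Matrix.of fun a b => metric (F w) (tangent F a w) (tangent F b w)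

/-- The second fundamental form in the direction of the normal vector `N`. -/
noncomputable def secondForm (F : ℂ → Fin 3 → ℝ) (w : ℂ) (N : Fin 3 → ℝ) :
    Matrix (Fin 2) (Fin 2) ℝ :=
  Matrix.of fun a b => metric (F w) (covDeriv F a b w) N

/-- `N` is a unit normal vector of the surface at the point with parameter `w`. -/
def IsUnitNormal (F : ℂ → Fin 3 → ℝ) (w : ℂ) (N : Fin 3 → ℝ) : Prop :=
  metric (F w) N N = 1 ∧ ∀ a, metric (F w) (tangent F a w) N = 0

/-- The mean curvature `H` with respect to the unit normal `N`: half the trace of the shape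
operator. -/
noncomputable def meanCurvature (F : ℂ → Fin 3 → ℝ) (w : ℂ) (N : Fin 3 → ℝ) : ℝ :=
  1 / 2 * ((firstForm F w)⁻¹ * secondForm F w N).trace

/-! ### Surfaces in Nil -/

section Surface

variable {M : Type*} [TopologicalSpace M] [ChartedSpace ℂ M]

/-- `f` is a `C²` immersion of the surface `M` into `Nil`. Here `M` is a real two-dimensional
manifold, modelled on `ℂ` as a real vector space. -/
structure IsImmersion (f : M → NilGroup) : Prop where
  contMDiff : ContMDiff 𝓘(ℝ, ℂ) 𝓘(ℝ, Fin 3 → ℝ) 2 (fun p => coords (f p))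
  injective : ∀ p : M,
    Function.Injective (mfderiv 𝓘(ℝ, ℂ) 𝓘(ℝ, Fin 3 → ℝ) (fun p => coords (f p)) p)

/-- The local coordinate expression of `f` in the chart `φ` of `M` and the chart `(x, y, z)`. -/
noncomputable def localRep (f : M → NilGroup) (φ : OpenPartialHomeomorph M ℂ) : ℂ → Fin 3 → ℝ :=
  fun w => coords (f (φ.symm w))

/-- `f` is minimal: its mean curvature vanishes identically (for either choice of the unit
normal, computed in arbitrary `C²` charts). -/
def IsMinimal (f : M → NilGroup) : Prop :=
  ∀ φ ∈ IsManifold.maximalAtlas 𝓘(ℝ, ℂ) 2 M, ∀ w ∈ φ.target, ∀ N,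
    IsUnitNormal (localRep f φ) w N → meanCurvature (localRep f φ) w N = 0

/-- The chart `φ` is a conformal parameter for `f`: the induced metric is
`exp (2α) (du² + dv²)` in it. -/
def IsConformalParameter (f : M → NilGroup) (φ : OpenPartialHomeomorph M ℂ) : Prop :=
  φ ∈ IsManifold.maximalAtlas 𝓘(ℝ, ℂ) 2 M ∧
    ∃ α : ℂ → ℝ, ∀ w ∈ φ.target,
      firstForm (localRep f φ) w = Real.exp (2 * α w) • (1 : Matrix (Fin 2) (Fin 2) ℝ)

/-- The Wirtinger derivative `∂ = (∂_u - i ∂_v) / 2`. -/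
noncomputable def dz (h : ℂ → ℂ) (w : ℂ) : ℂ :=
  1 / 2 * (fderiv ℝ h w 1 - Complex.I * fderiv ℝ h w Complex.I)

/-- The Wirtinger derivative `∂̄ = (∂_u + i ∂_v) / 2`. -/
noncomputable def dzbar (h : ℂ → ℂ) (w : ℂ) : ℂ :=
  1 / 2 * (fderiv ℝ h w 1 + Complex.I * fderiv ℝ h w Complex.I)

/-- The left translation `Ψ = f⁻¹ ∂f` of `∂f` to the complexified Lie algebra, for a map `g` from
the parameter domain to `Nil`. -/
noncomputable def leftLogDeriv (g : ℂ → NilGroup) (w : ℂ) : Matrix (Fin 3) (Fin 3) ℂ :=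
  (toMatrix (g w)⁻¹).map Complex.ofReal *
    Matrix.of fun i j => dz (fun ζ => (toMatrix (g ζ) i j : ℂ)) w

/-- `(ψ₁, ψ₂)` is a generating spinor of the surface `f` in the parameter `φ`: it is continuous and
`f⁻¹ ∂f = Z₁ e₁ + Z₂ e₂ + Z₃ e₃` with
`Z₁ = (i/2) (ψ̄₂² + ψ₁²)`, `Z₂ = (1/2) (ψ̄₂² - ψ₁²)`, `Z₃ = ψ₁ ψ̄₂`. -/
structure IsGeneratingSpinor (f : M → NilGroup) (φ : OpenPartialHomeomorph M ℂ)
    (ψ₁ ψ₂ : ℂ → ℂ) : Prop where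
  continuousOn_fst : ContinuousOn ψ₁ φ.target
  continuousOn_snd : ContinuousOn ψ₂ φ.target
  leftLogDeriv_eq : ∀ w ∈ φ.target,
    leftLogDeriv (fun ζ => f (φ.symm ζ)) w =
      (Complex.I / 2 * (star (ψ₂ w) ^ 2 + ψ₁ w ^ 2)) • lieBasis 0 +
        (1 / 2 * (star (ψ₂ w) ^ 2 - ψ₁ w ^ 2)) • lieBasis 1 +
        (ψ₁ w * star (ψ₂ w)) • lieBasis 2

end Surface

end NilGroup

/-!
Write `Z = f⁻¹ ∂f`, with components in the left invariant frame, and let `τ` be the trace of the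
covariant derivative of `df` for the flat metric of the parameter plane. Symmetry of the second
covariant derivative gives `∂̄Z = τ / 4 - ∇_{Z̄} Z`. The spinor parametrizes the cone `Z · Z = 0`;
differentiating this equation and using that `∇` is metric gives `Z · τ = 0`, so that `τ` is
`2 H (|ψ₁|² + |ψ₂|²)²` times the unit normal, which is itself an expression in the spinor. Hence
`∂̄Z` is an explicit function of `ψ₁`, `ψ₂` and `H`. It is tangent to the cone, and taking square
roots turns it into the Dirac equation for `(ψ₁, ψ₂)`, where `H = 0` in the minimal case.
-/

namespace NilGroup

open Complex
open scoped ComplexConjugate Topology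

section LeviCivita

/-- The linear isomorphism taking a tangent vector at `p` to its components `dx, dy, dz - x dy` in
the left invariant orthonormal frame `e₁, e₂, e₃`. -/
def frame (p : Fin 3 → ℝ) : (Fin 3 → ℝ) ≃ₗ[ℝ] (Fin 3 → ℝ) where
  toFun v := ![v 0, v 1, v 2 - p 0 * v 1]
  invFun c := ![c 0, c 1, c 2 + p 0 * c 1]
  map_add' u v := by ext k; fin_cases k <;> simp; ring
  map_smul' r v := by ext k; fin_cases k <;> simp; ring
  left_inv v := by ext k; fin_cases k <;> simp
  right_inv c := by ext k; fin_cases k <;> simp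

theorem frame_apply (p v : Fin 3 → ℝ) : frame p v = ![v 0, v 1, v 2 - p 0 * v 1] := rfl

theorem metric_eq_dotProduct_frame (p u v : Fin 3 → ℝ) :
    metric p u v = frame p u ⬝ᵥ frame p v := by
  simp only [metric, frame_apply, Matrix.vec3_dotProduct, Matrix.cons_val]

/-- The Levi-Civita connection `∇_X Y` on left invariant vector fields, in terms of the components
of `X` and `Y` in the frame `e₁, e₂, e₃`. The scalars may be complex, for use on the complexified
Lie algebra. -/
def leviCivita {K : Type*} [Field K] (X Y : Fin 3 → K) : Fin 3 → K :=
  ![(X 1 * Y 2 + X 2 * Y 1) / 2, -(X 0 * Y 2 + X 2 * Y 0) / 2, (X 0 * Y 1 - X 1 * Y 0) / 2]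

theorem dotProduct_leviCivita_self {K : Type*} [Field K] (X Y : Fin 3 → K) :
    Y ⬝ᵥ leviCivita X Y = 0 := by
  simp only [leviCivita, Matrix.vec3_dotProduct, Matrix.cons_val]
  ring

theorem gram_eq (p : Fin 3 → ℝ) :
    gram p = !![1, 0, 0; 0, 1 + p 0 ^ 2, -p 0; 0, -p 0, 1] := by
  ext i j
  fin_cases i <;> fin_cases j <;> simp [gram, metric, Pi.single_apply, sq]

theorem inv_gram_eq (p : Fin 3 → ℝ) :
    (gram p)⁻¹ = !![1, 0, 0; 0, 1, p 0; 0, p 0, 1 + p 0 ^ 2] := by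
  refine Matrix.inv_eq_left_inv ?_
  rw [gram_eq, Matrix.mul_fin_three, Matrix.one_fin_three]
  ring_nf

theorem hasFDerivAt_gram (p : Fin 3 → ℝ) (j l : Fin 3) :
    HasFDerivAt (fun q => gram q j l)
      ((!![0, 0, 0; 0, 2 * p 0, -1; 0, -1, 0] : Matrix (Fin 3) (Fin 3) ℝ) j l •
        ContinuousLinearMap.proj (R := ℝ) (φ := fun _ : Fin 3 => ℝ) 0) p := by
  have hx : HasFDerivAt (fun q : Fin 3 → ℝ => q 0)
      (ContinuousLinearMap.proj (R := ℝ) (φ := fun _ : Fin 3 => ℝ) 0) p := hasFDerivAt_apply 0 p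
  have hneg := hx.fun_neg.congr_fderiv (neg_one_smul ℝ _).symm
  have hsq := (hx.pow 2).const_add 1
  simp only [gram_eq]
  fin_cases j <;> fin_cases l <;> first | simpa using hsq | exact hneg | simp [hasFDerivAt_const]

theorem gramDeriv_eq (p : Fin 3 → ℝ) (i j l : Fin 3) :
    gramDeriv p i j l =
      (Pi.single 0 1 : Fin 3 → ℝ) i * !![0, 0, 0; 0, 2 * p 0, -1; 0, -1, 0] j l := by
  rw [gramDeriv, (hasFDerivAt_gram p j l).fderiv]
  fin_cases i <;> simp

theorem sum_christoffel (p u v : Fin 3 → ℝ) (k : Fin 3) :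
    ∑ i, ∑ j, christoffel p k i j * u i * v j =
      ![-p 0 * u 1 * v 1 + (u 1 * v 2 + u 2 * v 1) / 2,
        p 0 / 2 * (u 0 * v 1 + u 1 * v 0) - (u 0 * v 2 + u 2 * v 0) / 2,
        (p 0 ^ 2 - 1) / 2 * (u 0 * v 1 + u 1 * v 0) - p 0 / 2 * (u 0 * v 2 + u 2 * v 0)] k := by
  simp only [christoffel, inv_gram_eq, gramDeriv_eq, Fin.sum_univ_three]
  fin_cases k <;>
    simp only [Fin.isValue, Fin.zero_eta, Fin.mk_one, Fin.reduceFinMk, Matrix.of_apply,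
      Matrix.cons_val', Matrix.cons_val, Matrix.cons_val_fin_one, Pi.single_eq_same, ne_eq,
      one_ne_zero, Fin.reduceEq, not_false_eq_true, Pi.single_eq_of_ne] <;>
    ring

theorem sum_christoffel_comm (p u v : Fin 3 → ℝ) (k : Fin 3) :
    ∑ i, ∑ j, christoffel p k i j * u i * v j = ∑ i, ∑ j, christoffel p k i j * v i * u j := by
  simp only [sum_christoffel]
  fin_cases k <;>
    simp only [Fin.zero_eta, Fin.mk_one, Fin.reduceFinMk, Matrix.cons_val] <;> ring

-- The last term is due to `e₂ = ∂_y + x ∂_z` depending on the base point.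
theorem frame_sum_christoffel (p u v : Fin 3 → ℝ) :
    frame p (fun k => ∑ i, ∑ j, christoffel p k i j * u i * v j) =
      leviCivita (frame p u) (frame p v) - Pi.single 2 (u 0 * v 1) := by
  simp only [sum_christoffel]
  ext k
  fin_cases k <;>
    simp only [Fin.isValue, Fin.zero_eta, Fin.mk_one, Fin.reduceFinMk, frame_apply, leviCivita,
      Matrix.cons_val, Pi.sub_apply, Pi.single_eq_same, ne_eq, Fin.reduceEq, not_false_eq_true,
      Pi.single_eq_of_ne] <;>
    ring

end LeviCivita

section CovariantDerivative

variable {F : ℂ → Fin 3 → ℝ} {w : ℂ}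

theorem hasFDerivAt_frame {E : Type*} [NormedAddCommGroup E] [NormedSpace ℝ E]
    {p v : E → Fin 3 → ℝ} {p' v' : E →L[ℝ] Fin 3 → ℝ} {x : E}
    (hp : HasFDerivAt p p' x) (hv : HasFDerivAt v v' x) :
    HasFDerivAt (fun y => frame (p y) (v y))
      ((frame (p x)).toContinuousLinearEquiv.toContinuousLinearMap.comp v' -
        (ContinuousLinearMap.single ℝ (fun _ => ℝ) 2).comp
          (v x 1 • (ContinuousLinearMap.proj 0).comp p')) x := by
  rw [hasFDerivAt_pi'] at *
  intro k
  fin_cases k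
  · exact (hv 0).congr_fderiv (by ext; simp [frame_apply])
  · exact (hv 1).congr_fderiv (by ext; simp [frame_apply])
  · refine ((hv 2).fun_sub ((hp 0).fun_mul (hv 1))).congr_fderiv ?_
    ext
    simp only [sub_apply, add_apply, smul_apply, smul_eq_mul, ContinuousLinearMap.comp_apply,
      ContinuousLinearMap.proj_apply, ContinuousLinearEquiv.coe_coe, Fin.reduceFinMk, Pi.sub_apply,
      LinearEquiv.coe_toContinuousLinearEquiv', frame_apply, Matrix.cons_val,
      ContinuousLinearMap.single_apply, Pi.single_eq_same]
    ring

theorem hasFDerivAt_tangent (hF : ContDiffAt ℝ 2 F w) (b : Fin 2) :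
    HasFDerivAt (tangent F b) ((fderiv ℝ (fderiv ℝ F) w).flip (dir b)) w := by
  have h : DifferentiableAt ℝ (fderiv ℝ F) w :=
    (hF.fderiv_right (m := 1) (by norm_num)).differentiableAt (by norm_num)
  exact (ContinuousLinearMap.apply ℝ (Fin 3 → ℝ) (dir b)).hasFDerivAt.comp w h.hasFDerivAt

theorem differentiableAt_frame_tangent (hF : ContDiffAt ℝ 2 F w) (b : Fin 2) :
    DifferentiableAt ℝ (fun ζ => frame (F ζ) (tangent F b ζ)) w :=
  (hasFDerivAt_frame (hF.differentiableAt (by norm_num)).hasFDerivAt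
    (hasFDerivAt_tangent hF b)).differentiableAt

theorem covDeriv_comm (hF : ContDiffAt ℝ 2 F w) (a b : Fin 2) :
    covDeriv F a b w = covDeriv F b a w := by
  ext k
  have hsymm : fderiv ℝ (tangent F b) w (dir a) = fderiv ℝ (tangent F a) w (dir b) := by
    rw [(hasFDerivAt_tangent hF a).fderiv, (hasFDerivAt_tangent hF b).fderiv]
    exact hF.isSymmSndFDerivAt (by simp) (dir a) (dir b)
  simp only [covDeriv, hsymm, sum_christoffel_comm (F w) (tangent F a w)]

theorem frame_covDeriv (hF : ContDiffAt ℝ 2 F w) (a b : Fin 2) :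
    frame (F w) (covDeriv F a b w) =
      fderiv ℝ (fun ζ => frame (F ζ) (tangent F b ζ)) w (dir a) +
        leviCivita (frame (F w) (tangent F a w)) (frame (F w) (tangent F b w)) := by
  have hsplit : covDeriv F a b w = fderiv ℝ (tangent F b) w (dir a) + fun k =>
      ∑ i, ∑ j, christoffel (F w) k i j * tangent F a w i * tangent F b w j := rfl
  rw [hsplit, map_add, frame_sum_christoffel,
    (hasFDerivAt_frame (hF.differentiableAt (by norm_num)).hasFDerivAt
      (hasFDerivAt_tangent hF b)).fderiv, (hasFDerivAt_tangent hF b).fderiv]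
  ext k
  fin_cases k <;> simp [tangent, mul_comm]; ring

end CovariantDerivative

section Wirtinger

/-- `h` is real differentiable at `w` and its Wirtinger derivative `∂̄h` has the value `h'` there.
Carrying differentiability along keeps `dzbar` away from its junk values. -/
def HasDzbarAt (h : ℂ → ℂ) (h' w : ℂ) : Prop :=
  DifferentiableAt ℝ h w ∧ dzbar h w = h'

variable {a b : ℂ → ℂ} {a' b' w : ℂ}

theorem HasDzbarAt.congr_of_eventuallyEq (ha : HasDzbarAt a a' w) (h : b =ᶠ[𝓝 w] a) :
    HasDzbarAt b a' w :=
  ⟨ha.1.congr_of_eventuallyEq h, by rw [← ha.2, dzbar, dzbar, h.fderiv_eq]⟩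

theorem HasDzbarAt.add (ha : HasDzbarAt a a' w) (hb : HasDzbarAt b b' w) :
    HasDzbarAt (fun ζ => a ζ + b ζ) (a' + b') w := by
  refine ⟨ha.1.fun_add hb.1, ?_⟩
  rw [← ha.2, ← hb.2]
  simp only [dzbar, fderiv_fun_add ha.1 hb.1, add_apply]
  ring

theorem HasDzbarAt.mul (ha : HasDzbarAt a a' w) (hb : HasDzbarAt b b' w) :
    HasDzbarAt (fun ζ => a ζ * b ζ) (a' * b w + a w * b') w := by
  refine ⟨ha.1.fun_mul hb.1, ?_⟩
  rw [← ha.2, ← hb.2]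
  simp only [dzbar, fderiv_fun_mul ha.1 hb.1, add_apply, smul_apply, smul_eq_mul]
  ring

theorem HasDzbarAt.const_mul (c : ℂ) (ha : HasDzbarAt a a' w) :
    HasDzbarAt (fun ζ => c * a ζ) (c * a') w := by
  refine ⟨ha.1.const_mul c, ?_⟩
  rw [← ha.2]
  simp only [dzbar, fderiv_const_mul ha.1, smul_apply, smul_eq_mul]
  ring

theorem fderiv_ofReal_apply {x : ℂ → ℝ} (hx : DifferentiableAt ℝ x w) (v : ℂ) :
    fderiv ℝ (fun ζ => (x ζ : ℂ)) w v = fderiv ℝ x w v :=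
  congrArg (· v) (ofRealCLM.hasFDerivAt.comp w hx.hasFDerivAt).fderiv

theorem hasDzbarAt_ofReal {x : ℂ → ℝ} (hx : DifferentiableAt ℝ x w) :
    HasDzbarAt (fun ζ => (x ζ : ℂ)) ((fderiv ℝ x w 1 + I * fderiv ℝ x w I) / 2) w := by
  refine ⟨ofRealCLM.differentiableAt.comp w hx, ?_⟩
  simp only [dzbar, fderiv_ofReal_apply hx]
  ring

theorem dz_eq_of_hasDzbarAt_star (h : HasDzbarAt (fun ζ => star (a ζ)) b' w) :
    dz a w = star b' := by
  rw [← h.2, dzbar, dz, fderiv_star]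
  simp only [ContinuousLinearMap.comp_apply, ContinuousLinearEquiv.coe_coe, starL'_apply, star_def,
    map_mul, map_add, map_div₀, map_one, map_ofNat, conj_conj, conj_I]
  ring

theorem dz_ofReal {x : ℂ → ℝ} (hx : DifferentiableAt ℝ x w) :
    dz (fun ζ => (x ζ : ℂ)) w = (fderiv ℝ x w 1 - I * fderiv ℝ x w I) / 2 := by
  simp only [dz, fderiv_ofReal_apply hx]
  ring

theorem differentiableAt_of_differentiableAt_pow {𝕜 : Type*} [NontriviallyNormedField 𝕜]
    {E : Type*} [NormedAddCommGroup E] [NormedSpace 𝕜 E] {K : Type*} [NontriviallyNormedField K]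
    [CompleteSpace K] [CharZero K] [NormedAlgebra 𝕜 K] {h : E → K} {x : E} {n : ℕ} (hn : n ≠ 0)
    (hcont : ContinuousAt h x) (hx : h x ≠ 0) (hpow : DifferentiableAt 𝕜 (fun y => h y ^ n) x) :
    DifferentiableAt 𝕜 h x := by
  have hstrict := hasStrictDerivAt_pow n (h x)
  have hne : (n : K) * h x ^ (n - 1) ≠ 0 :=
    mul_ne_zero (Nat.cast_ne_zero.2 hn) (pow_ne_zero _ hx)
  have hroot := ((hstrict.to_localInverse hne).hasDerivAt.differentiableAt.restrictScalars 𝕜).comp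
    (f := fun y => h y ^ n) x hpow
  refine hroot.congr_of_eventuallyEq ?_
  filter_upwards [hcont.eventually (hstrict.hasStrictFDerivAt_equiv hne).eventually_left_inverse]
    with y hy
  exact hy.symm

theorem hasDzbarAt_of_hasDzbarAt_sq_of_hasDzbarAt_mul (hb : ContinuousAt b w) (hbw : b w ≠ 0)
    (hsq : HasDzbarAt (fun ζ => b ζ ^ 2) (2 * b w * b') w)
    (hmul : HasDzbarAt (fun ζ => a ζ * b ζ) (a' * b w + a w * b') w) :
    HasDzbarAt a a' w ∧ HasDzbarAt b b' w := by
  have hdb : DifferentiableAt ℝ b w :=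
    differentiableAt_of_differentiableAt_pow two_ne_zero hb hbw hsq.1
  have hda : DifferentiableAt ℝ a w := by
    refine (hmul.1.mul (hdb.inv hbw)).congr_of_eventuallyEq ?_
    filter_upwards [hb.eventually_ne hbw] with ζ hζ
    simp [hζ]
  have hbbar : HasDzbarAt b (dzbar b w) w := ⟨hdb, rfl⟩
  have habar : HasDzbarAt a (dzbar a w) w := ⟨hda, rfl⟩
  have hb' : dzbar b w = b' := by
    have h := (hbbar.mul hbbar).2
    simp only [← sq, hsq.2] at h
    exact mul_left_cancel₀ hbw (by linear_combination -h / 2)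
  refine ⟨⟨hda, ?_⟩, hdb, hb'⟩
  have h := (habar.mul hbbar).2
  rw [hmul.2, hb'] at h
  exact mul_right_cancel₀ hbw (by linear_combination -h)

end Wirtinger

section MaurerCartan

variable {F : ℂ → Fin 3 → ℝ} {w : ℂ}

/-- The components `Z₁, Z₂, Z₃` of the Maurer-Cartan form `F⁻¹ ∂F` in the left invariant frame, for
a map `F` given in the coordinates of `Nil`. -/
noncomputable def maurerCartan (F : ℂ → Fin 3 → ℝ) (w : ℂ) : Fin 3 → ℂ := fun k =>
  ((frame (F w) (tangent F 0 w) k : ℂ) - I * frame (F w) (tangent F 1 w) k) / 2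

/-- The tension field of `F` with respect to the flat metric `du² + dv²` of the parameter plane. -/
noncomputable def tension (F : ℂ → Fin 3 → ℝ) (w : ℂ) : Fin 3 → ℝ :=
  covDeriv F 0 0 w + covDeriv F 1 1 w

theorem sum_smul_lieBasis (c : Fin 3 → ℂ) :
    ∑ k, c k • lieBasis k = !![0, c 0, c 2; 0, 0, c 1; 0, 0, 0] := by
  ext i j
  fin_cases i <;> fin_cases j <;> simp [lieBasis, Fin.sum_univ_three]

theorem maurerCartan_eq (hF : DifferentiableAt ℝ F w) :
    maurerCartan F w = ![dz (fun ζ => (F ζ 0 : ℂ)) w, dz (fun ζ => (F ζ 1 : ℂ)) w,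
      dz (fun ζ => (F ζ 2 : ℂ)) w - F w 0 * dz (fun ζ => (F ζ 1 : ℂ)) w] := by
  have hcoord := differentiableAt_pi.1 hF
  have htangent (a : Fin 2) (k : Fin 3) :
      tangent F a w k = fderiv ℝ (fun ζ => F ζ k) w (dir a) := by
    rw [tangent, fderiv_pi hcoord]
    rfl
  ext k
  fin_cases k <;>
    simp only [Fin.zero_eta, Fin.mk_one, Fin.reduceFinMk, maurerCartan, frame_apply, htangent, dir,
      Matrix.cons_val, dz_ofReal (hcoord _), ofReal_sub, ofReal_mul]
  ring

theorem leftLogDeriv_eq_sum_smul_lieBasis {g : ℂ → NilGroup}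
    (hg : DifferentiableAt ℝ (fun ζ => coords (g ζ)) w) :
    leftLogDeriv g w = ∑ k, maurerCartan (fun ζ => coords (g ζ)) w k • lieBasis k := by
  have hconst (c : ℂ) : dz (fun _ => c) w = 0 := by simp [dz]
  rw [sum_smul_lieBasis, maurerCartan_eq hg]
  ext i j
  fin_cases i <;> fin_cases j <;>
    simp [leftLogDeriv, toMatrix, Matrix.mul_apply, Fin.sum_univ_three, inv_def, coords, hconst,
      sub_eq_add_neg, add_comm]

theorem hasDzbarAt_maurerCartan (hF : ContDiffAt ℝ 2 F w) (k : Fin 3) :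
    HasDzbarAt (fun ζ => maurerCartan F ζ k)
      (frame (F w) (tension F w) k / 4 -
        leviCivita (star (maurerCartan F w)) (maurerCartan F w) k) w := by
  have hcomp (a : Fin 2) := differentiableAt_pi.1 (differentiableAt_frame_tangent hF a) k
  have hfderiv (a b : Fin 2) :
      fderiv ℝ (fun ζ => frame (F ζ) (tangent F b ζ) k) w (dir a) =
        frame (F w) (covDeriv F a b w) k -
          leviCivita (frame (F w) (tangent F a w)) (frame (F w) (tangent F b w)) k := by
    rw [frame_covDeriv hF, fderiv_pi (differentiableAt_pi.1 (differentiableAt_frame_tangent hF b))]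
    simp
  have hcomb := ((hasDzbarAt_ofReal (hcomp 0)).const_mul (1 / 2)).add
    ((hasDzbarAt_ofReal (hcomp 1)).const_mul (-(I / 2)))
  have h := hcomb.congr_of_eventuallyEq (b := fun ζ => maurerCartan F ζ k)
    (.of_forall fun ζ => by simp only [maurerCartan]; ring)
  refine ⟨h.1, h.2.trans ?_⟩
  have hu (b : Fin 2) := hfderiv 0 b
  have hv (b : Fin 2) := hfderiv 1 b
  simp only [dir, Matrix.cons_val] at hu hv
  simp only [hu, hv, covDeriv_comm hF 1 0, tension, map_add, Pi.add_apply]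
  fin_cases k <;>
    simp only [Fin.zero_eta, Fin.mk_one, Fin.reduceFinMk, leviCivita, maurerCartan, Matrix.cons_val,
      Pi.star_apply, star_def, map_sub, map_mul, map_div₀, map_ofNat, conj_ofReal, conj_I,
      ofReal_neg, ofReal_sub, ofReal_add, ofReal_mul, ofReal_div, ofReal_ofNat] <;>
    ring_nf <;> simp only [I_sq] <;> ring

theorem maurerCartan_dotProduct_frame_tension (hF : ContDiffAt ℝ 2 F w)
    (hconf : ∀ᶠ ζ in 𝓝 w, maurerCartan F ζ ⬝ᵥ maurerCartan F ζ = 0) :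
    maurerCartan F w ⬝ᵥ (fun k => (frame (F w) (tension F w) k : ℂ)) = 0 := by
  have hZ := hasDzbarAt_maurerCartan hF
  have hself := (((hZ 0).mul (hZ 0)).add ((hZ 1).mul (hZ 1))).add ((hZ 2).mul (hZ 2))
  have hzero := hself.congr_of_eventuallyEq (b := fun _ => 0) (by
    filter_upwards [hconf] with ζ hζ
    rw [← hζ, Matrix.vec3_dotProduct])
  have hskew := dotProduct_leviCivita_self (star (maurerCartan F w)) (maurerCartan F w)
  rw [Matrix.vec3_dotProduct] at hskew ⊢
  have h := hzero.2
  simp only [dzbar, fderiv_const_apply, zero_apply] at h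
  linear_combination -2 * h + 4 * hskew

theorem maurerCartan_dotProduct_self (F : ℂ → Fin 3 → ℝ) (w : ℂ) :
    maurerCartan F w ⬝ᵥ maurerCartan F w =
      (firstForm F w 0 0 - firstForm F w 1 1 : ℝ) / 4 - I / 2 * firstForm F w 0 1 := by
  simp only [firstForm, metric_eq_dotProduct_frame, maurerCartan, Matrix.vec3_dotProduct,
    Matrix.of_apply, ofReal_sub, ofReal_add, ofReal_mul]
  ring_nf
  simp only [I_sq]
  ring

theorem maurerCartan_dotProduct_star (F : ℂ → Fin 3 → ℝ) (w : ℂ) :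
    maurerCartan F w ⬝ᵥ star (maurerCartan F w) =
      (firstForm F w 0 0 + firstForm F w 1 1 : ℝ) / 4 := by
  simp only [firstForm, metric_eq_dotProduct_frame, maurerCartan, Matrix.vec3_dotProduct,
    Matrix.of_apply, ofReal_add, ofReal_mul, Pi.star_apply, star_def, map_sub, map_mul, map_div₀,
    map_ofNat, conj_ofReal, conj_I]
  ring_nf
  simp only [I_sq]
  ring

theorem firstForm_eq_smul_one {r : ℝ} (hself : maurerCartan F w ⬝ᵥ maurerCartan F w = 0)
    (hstar : maurerCartan F w ⬝ᵥ star (maurerCartan F w) = (r / 2 : ℝ)) :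
    firstForm F w = r • (1 : Matrix (Fin 2) (Fin 2) ℝ) := by
  rw [maurerCartan_dotProduct_self, Complex.ext_iff] at hself
  rw [maurerCartan_dotProduct_star] at hstar
  norm_cast at hstar
  have hsymm : firstForm F w 1 0 = firstForm F w 0 1 := by
    simp only [firstForm, metric_eq_dotProduct_frame, Matrix.of_apply, dotProduct_comm]
  simp only [sub_re, sub_im, mul_re, mul_im, div_ofNat_re, div_ofNat_im, ofReal_re, ofReal_im,
    I_re, I_im, zero_re, zero_im] at hself
  ext a b
  fin_cases a <;> fin_cases b <;>
    simp only [Fin.isValue, Fin.zero_eta, Fin.mk_one, Matrix.smul_apply, Matrix.one_apply_eq, ne_eq,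
      zero_ne_one, one_ne_zero, not_false_eq_true, Matrix.one_apply_ne, smul_eq_mul] <;>
    linarith

theorem meanCurvature_eq_of_firstForm_eq_smul_one {r : ℝ} (hr : r ≠ 0)
    (h : firstForm F w = r • (1 : Matrix (Fin 2) (Fin 2) ℝ)) (N : Fin 3 → ℝ) :
    meanCurvature F w N = metric (F w) (tension F w) N / (2 * r) := by
  have hinv : (firstForm F w)⁻¹ = r⁻¹ • (1 : Matrix (Fin 2) (Fin 2) ℝ) :=
    Matrix.inv_eq_left_inv (by simp [h, hr])
  have hadd : metric (F w) (tension F w) N =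
      metric (F w) (covDeriv F 0 0 w) N + metric (F w) (covDeriv F 1 1 w) N := by
    simp only [metric_eq_dotProduct_frame, tension, map_add, add_dotProduct]
  rw [meanCurvature, hinv, hadd]
  simp only [secondForm, smul_mul_assoc, one_mul, Matrix.trace_smul, Matrix.trace_fin_two,
    Matrix.of_apply, smul_eq_mul]
  field_simp

end MaurerCartan

section Spinor

variable {a b : ℂ}

/-- The components `(Z₁, Z₂, Z₃)` of `f⁻¹ ∂f` attached to the spinor `(ψ₁, ψ₂) = (a, b)`. -/
noncomputable def spinorVec (a b : ℂ) : Fin 3 → ℂ :=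
  ![I / 2 * (conj b ^ 2 + a ^ 2), 1 / 2 * (conj b ^ 2 - a ^ 2), a * conj b]

/-- The unit normal, in the left invariant frame, of a surface with spinor `(ψ₁, ψ₂) = (a, b)`. It
has the junk value `0` for the zero spinor. -/
noncomputable def spinorNormal (a b : ℂ) : Fin 3 → ℝ :=
  (‖a‖ ^ 2 + ‖b‖ ^ 2)⁻¹ • ![-2 * (a * b).im, -2 * (a * b).re, ‖b‖ ^ 2 - ‖a‖ ^ 2]

/-- The potential `H e^α / 2 + i (|ψ₂|² - |ψ₁|²) / 4` of the Dirac equation of a surface in `Nil`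
with mean curvature `H`, where `(ψ₁, ψ₂) = (a, b)` and `e^α = |ψ₁|² + |ψ₂|²`. -/
noncomputable def diracPotential (H : ℝ) (a b : ℂ) : ℂ :=
  H / 2 * (‖a‖ ^ 2 + ‖b‖ ^ 2) + I / 4 * (‖b‖ ^ 2 - ‖a‖ ^ 2)

theorem conj_diracPotential (H : ℝ) (a b : ℂ) :
    conj (diracPotential H a b) =
      H / 2 * (‖a‖ ^ 2 + ‖b‖ ^ 2) - I / 4 * (‖b‖ ^ 2 - ‖a‖ ^ 2) := by
  simp only [diracPotential, map_add, map_sub, map_mul, map_div₀, map_pow, map_ofNat, conj_ofReal,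
    conj_I]
  ring

theorem sq_norm_add_sq_norm_pos (h : a ≠ 0 ∨ b ≠ 0) : 0 < ‖a‖ ^ 2 + ‖b‖ ^ 2 := by
  rcases h with ha | hb <;> positivity

theorem mul_conj_add_mul_conj_ne_zero (h : a ≠ 0 ∨ b ≠ 0) : a * conj a + b * conj b ≠ 0 := by
  simp only [mul_conj']
  exact_mod_cast (sq_norm_add_sq_norm_pos h).ne'

theorem spinorVec_dotProduct_self (a b : ℂ) : spinorVec a b ⬝ᵥ spinorVec a b = 0 := by
  simp only [spinorVec, Matrix.vec3_dotProduct, Matrix.cons_val]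
  linear_combination (conj b ^ 2 + a ^ 2) ^ 2 / 4 * I_sq

theorem spinorVec_dotProduct_star (a b : ℂ) :
    spinorVec a b ⬝ᵥ star (spinorVec a b) = ((‖a‖ ^ 2 + ‖b‖ ^ 2) ^ 2 / 2 : ℝ) := by
  simp only [Matrix.vec3_dotProduct, spinorVec, Pi.star_apply, Matrix.cons_val]
  simp only [star_def, map_add, map_sub, map_mul, map_pow, map_div₀, map_one, map_ofNat, conj_I,
    conj_conj, ofReal_div, ofReal_pow, ofReal_add, ofReal_ofNat, ← mul_conj']
  linear_combination -(conj b ^ 2 + a ^ 2) * (b ^ 2 + conj a ^ 2) / 4 * I_sq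

theorem spinorNormal_dotProduct_self (h : a ≠ 0 ∨ b ≠ 0) :
    spinorNormal a b ⬝ᵥ spinorNormal a b = 1 := by
  have hpos := sq_norm_add_sq_norm_pos h
  simp only [spinorNormal, smul_dotProduct, dotProduct_smul, smul_eq_mul, Matrix.vec3_dotProduct,
    Matrix.cons_val]
  field_simp
  simp only [Complex.sq_norm, normSq_apply, mul_re, mul_im]
  ring

theorem ofReal_spinorNormal (a b : ℂ) (k : Fin 3) :
    (spinorNormal a b k : ℂ) = (a * conj a + b * conj b)⁻¹ *
      ![I * (a * b - conj a * conj b), -(a * b + conj a * conj b), b * conj b - a * conj a] k := by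
  have hre : ((a * b).re : ℂ) = (a * b + conj a * conj b) / 2 := by
    rw [re_eq_add_conj, map_mul]
  have him : ((a * b).im : ℂ) = (a * b - conj a * conj b) / (2 * I) := by
    rw [im_eq_sub_conj, map_mul]
  fin_cases k <;>
    simp only [Fin.zero_eta, Fin.mk_one, Fin.reduceFinMk, spinorNormal, Pi.smul_apply, smul_eq_mul,
      Matrix.cons_val, ofReal_mul, ofReal_inv, ofReal_add, ofReal_sub, ofReal_neg, ofReal_pow,
      ofReal_ofNat, hre, him, ← mul_conj']
  · field_simp
    rw [I_sq]
    ring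
  · ring

theorem spinorVec_dotProduct_spinorNormal (a b : ℂ) :
    spinorVec a b ⬝ᵥ (fun k => (spinorNormal a b k : ℂ)) = 0 := by
  simp only [Matrix.vec3_dotProduct, ofReal_spinorNormal, spinorVec, Matrix.cons_val]
  linear_combination (a * conj a + b * conj b)⁻¹ * (conj b ^ 2 + a ^ 2) *
    (a * b - conj a * conj b) / 2 * I_sq

theorem eq_smul_spinorNormal (h : a ≠ 0 ∨ b ≠ 0) {τ : Fin 3 → ℝ}
    (hτ : spinorVec a b ⬝ᵥ (fun k => (τ k : ℂ)) = 0) :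
    τ = (τ ⬝ᵥ spinorNormal a b) • spinorNormal a b := by
  have hne := mul_conj_add_mul_conj_ne_zero h
  rw [Matrix.vec3_dotProduct] at hτ
  have hstar := congrArg conj hτ
  simp only [spinorVec, Matrix.cons_val, map_add, map_sub, map_mul, map_div₀, map_pow, map_one,
    map_zero, map_ofNat, conj_conj, conj_ofReal, conj_I] at hτ hstar
  ext k
  apply ofReal_injective
  simp only [Matrix.vec3_dotProduct, Pi.smul_apply, smul_eq_mul, ofReal_mul, ofReal_add,
    ofReal_spinorNormal]
  fin_cases k <;>
    simp only [Fin.zero_eta, Fin.mk_one, Fin.reduceFinMk, Matrix.cons_val] <;> field_simp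
  · linear_combination -I * ((b ^ 2 + conj a ^ 2) * hτ - (a ^ 2 + conj b ^ 2) * hstar) +
      τ 0 * (a * conj a + b * conj b) ^ 2 * I_sq
  · linear_combination (b ^ 2 - conj a ^ 2) * hτ + (conj b ^ 2 - a ^ 2) * hstar
  · linear_combination 2 * conj a * b * hτ + 2 * a * conj b * hstar

-- The right side is the differential of `spinorVec` in the direction `(U ψ₂, -Ū ψ̄₁)` for
-- `(ψ₁, ψ̄₂)`, where `U` is the Dirac potential.
theorem smul_spinorNormal_sub_leviCivita_spinorVec (H : ℝ) (k : Fin 3) :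
    (((2 * H * (‖a‖ ^ 2 + ‖b‖ ^ 2) ^ 2) • spinorNormal a b) k : ℝ) / 4 -
        leviCivita (star (spinorVec a b)) (spinorVec a b) k =
      ![I * (conj b * -(conj (diracPotential H a b) * conj a) + a * (diracPotential H a b * b)),
        conj b * -(conj (diracPotential H a b) * conj a) - a * (diracPotential H a b * b),
        diracPotential H a b * b * conj b + a * -(conj (diracPotential H a b) * conj a)] k := by
  simp only [Pi.smul_apply, smul_eq_mul, ofReal_mul, ofReal_spinorNormal]
  rw [conj_diracPotential, diracPotential]
  fin_cases k <;>
    simp only [Fin.zero_eta, Fin.mk_one, Fin.reduceFinMk, spinorVec, leviCivita, Matrix.cons_val,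
      Pi.star_apply, star_def, map_add, map_sub, map_mul, map_div₀, map_pow, map_one, map_ofNat,
      conj_conj, conj_I, ofReal_add, ofReal_pow, ofReal_ofNat, ← mul_conj'] <;>
    field_simp
  · ring_nf
    simp only [I_sq]
    ring
  · ring
  · ring

theorem hasDzbarAt_of_hasDzbarAt_spinorVec {ψ₁ ψ₂ : ℂ → ℂ} {w α β : ℂ}
    (hψ₁ : ContinuousAt ψ₁ w) (hψ₂ : ContinuousAt ψ₂ w) (hne : ψ₁ w ≠ 0 ∨ ψ₂ w ≠ 0)
    (h : ∀ k, HasDzbarAt (fun ζ => spinorVec (ψ₁ ζ) (ψ₂ ζ) k)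
      (![I * (conj (ψ₂ w) * β + ψ₁ w * α), conj (ψ₂ w) * β - ψ₁ w * α,
        α * conj (ψ₂ w) + ψ₁ w * β] k) w) :
    HasDzbarAt ψ₁ α w ∧ HasDzbarAt (fun ζ => conj (ψ₂ ζ)) β w := by
  have hsq₁ : HasDzbarAt (fun ζ => ψ₁ ζ ^ 2) (2 * ψ₁ w * α) w := by
    convert ((h 0).const_mul (-I)).add ((h 1).const_mul (-1)) using 1
    · ext ζ
      simp only [spinorVec, Matrix.cons_val]
      linear_combination (conj (ψ₂ ζ) ^ 2 + ψ₁ ζ ^ 2) / 2 * I_sq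
    · simp only [Matrix.cons_val]
      linear_combination (conj (ψ₂ w) * β + ψ₁ w * α) * I_sq
  have hsq₂ : HasDzbarAt (fun ζ => conj (ψ₂ ζ) ^ 2) (2 * conj (ψ₂ w) * β) w := by
    convert ((h 0).const_mul (-I)).add (h 1) using 1
    · ext ζ
      simp only [spinorVec, Matrix.cons_val]
      linear_combination (conj (ψ₂ ζ) ^ 2 + ψ₁ ζ ^ 2) / 2 * I_sq
    · simp only [Matrix.cons_val]
      linear_combination (conj (ψ₂ w) * β + ψ₁ w * α) * I_sq
  have hmul : HasDzbarAt (fun ζ => ψ₁ ζ * conj (ψ₂ ζ)) (α * conj (ψ₂ w) + ψ₁ w * β) w := h 2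
  rcases hne with h₁ | h₂
  · refine (hasDzbarAt_of_hasDzbarAt_sq_of_hasDzbarAt_mul hψ₁ h₁ hsq₁ ?_).symm
    simpa only [mul_comm, add_comm] using hmul
  · exact hasDzbarAt_of_hasDzbarAt_sq_of_hasDzbarAt_mul hψ₂.star (star_ne_zero.2 h₂) hsq₂ hmul

end Spinor

section DiracEquation

variable {F : ℂ → Fin 3 → ℝ} {ψ₁ ψ₂ : ℂ → ℂ} {w : ℂ}

theorem firstForm_eq_of_maurerCartan_eq_spinorVec {a b : ℂ}
    (hZ : maurerCartan F w = spinorVec a b) :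
    firstForm F w = ((‖a‖ ^ 2 + ‖b‖ ^ 2) ^ 2) • (1 : Matrix (Fin 2) (Fin 2) ℝ) := by
  apply firstForm_eq_smul_one
  · rw [hZ, spinorVec_dotProduct_self]
  · rw [hZ, spinorVec_dotProduct_star]

theorem isUnitNormal_spinorNormal {a b : ℂ} (hne : a ≠ 0 ∨ b ≠ 0)
    (hZ : maurerCartan F w = spinorVec a b) :
    IsUnitNormal F w ((frame (F w)).symm (spinorNormal a b)) := by
  have hort := spinorVec_dotProduct_spinorNormal a b
  simp only [← hZ, Complex.ext_iff] at hort
  refine ⟨?_, fun c => ?_⟩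
  · rw [metric_eq_dotProduct_frame, LinearEquiv.apply_symm_apply, spinorNormal_dotProduct_self hne]
  · rw [metric_eq_dotProduct_frame, LinearEquiv.apply_symm_apply]
    simp only [maurerCartan, Matrix.vec3_dotProduct, add_re, add_im, mul_re, mul_im, sub_re, sub_im,
      div_ofNat_re, div_ofNat_im, ofReal_re, ofReal_im, I_re, I_im, zero_re, zero_im] at hort
    fin_cases c <;> simp only [Fin.zero_eta, Fin.mk_one, Matrix.vec3_dotProduct] <;> linarith

theorem frame_tension_eq_smul_spinorNormal (hF : ContDiffAt ℝ 2 F w)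
    (hne : ψ₁ w ≠ 0 ∨ ψ₂ w ≠ 0)
    (hψ : ∀ᶠ ζ in 𝓝 w, maurerCartan F ζ = spinorVec (ψ₁ ζ) (ψ₂ ζ)) :
    frame (F w) (tension F w) =
      (2 * meanCurvature F w ((frame (F w)).symm (spinorNormal (ψ₁ w) (ψ₂ w))) *
        (‖ψ₁ w‖ ^ 2 + ‖ψ₂ w‖ ^ 2) ^ 2) • spinorNormal (ψ₁ w) (ψ₂ w) := by
  have hpos := sq_norm_add_sq_norm_pos hne
  have hort := maurerCartan_dotProduct_frame_tension hF
    (hψ.mono fun ζ hζ => by rw [hζ, spinorVec_dotProduct_self])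
  rw [hψ.self_of_nhds] at hort
  rw [meanCurvature_eq_of_firstForm_eq_smul_one (pow_pos hpos 2).ne'
      (firstForm_eq_of_maurerCartan_eq_spinorVec hψ.self_of_nhds),
    metric_eq_dotProduct_frame, LinearEquiv.apply_symm_apply]
  convert eq_smul_spinorNormal hne hort using 2
  field_simp

theorem dirac_equation (hF : ContDiffAt ℝ 2 F w) (hψ₁ : ContinuousAt ψ₁ w)
    (hψ₂ : ContinuousAt ψ₂ w) (hne : ψ₁ w ≠ 0 ∨ ψ₂ w ≠ 0)
    (hψ : ∀ᶠ ζ in 𝓝 w, maurerCartan F ζ = spinorVec (ψ₁ ζ) (ψ₂ ζ)) {U : ℂ}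
    (hU : U = diracPotential
      (meanCurvature F w ((frame (F w)).symm (spinorNormal (ψ₁ w) (ψ₂ w)))) (ψ₁ w) (ψ₂ w)) :
    DifferentiableAt ℝ ψ₁ w ∧ DifferentiableAt ℝ ψ₂ w ∧
      dzbar ψ₁ w = U * ψ₂ w ∧ dz ψ₂ w = -(U * ψ₁ w) := by
  have hZ (k : Fin 3) := (hasDzbarAt_maurerCartan hF k).congr_of_eventuallyEq
    (b := fun ζ => spinorVec (ψ₁ ζ) (ψ₂ ζ) k) (hψ.mono fun ζ hζ => (congrFun hζ k).symm)
  simp only [frame_tension_eq_smul_spinorNormal hF hne hψ, hψ.self_of_nhds,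
    smul_spinorNormal_sub_leviCivita_spinorVec, ← hU] at hZ
  obtain ⟨h₁, h₂⟩ := hasDzbarAt_of_hasDzbarAt_spinorVec hψ₁ hψ₂ hne hZ
  refine ⟨h₁.1, by simpa using h₂.1.star, h₁.2, ?_⟩
  simpa using dz_eq_of_hasDzbarAt_star h₂

end DiracEquation

section Surface

variable {M : Type*} [TopologicalSpace M] {f : M → NilGroup}
  {φ : OpenPartialHomeomorph M ℂ} {ψ₁ ψ₂ : ℂ → ℂ} {w : ℂ}

theorem IsGeneratingSpinor.maurerCartan_eq_spinorVec (hψ : IsGeneratingSpinor f φ ψ₁ ψ₂)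
    (hw : w ∈ φ.target) (hF : DifferentiableAt ℝ (localRep f φ) w) :
    maurerCartan (localRep f φ) w = spinorVec (ψ₁ w) (ψ₂ w) := by
  have h : ∑ k, maurerCartan (localRep f φ) w k • lieBasis k =
      ∑ k, spinorVec (ψ₁ w) (ψ₂ w) k • lieBasis k := by
    refine (leftLogDeriv_eq_sum_smul_lieBasis hF).symm.trans ((hψ.leftLogDeriv_eq w hw).trans ?_)
    rw [Fin.sum_univ_three]
    rfl
  simp only [sum_smul_lieBasis] at h
  ext k
  fin_cases k
  · exact congrFun₂ h 0 1
  · exact congrFun₂ h 1 2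
  · exact congrFun₂ h 0 2

variable [ChartedSpace ℂ M]

theorem contDiffAt_localRep [IsManifold 𝓘(ℝ, ℂ) 2 M]
    (hf : ContMDiffOn 𝓘(ℝ, ℂ) 𝓘(ℝ, Fin 3 → ℝ) 2 (fun p => coords (f p)) φ.source)
    (hφ : φ ∈ IsManifold.maximalAtlas 𝓘(ℝ, ℂ) 2 M) (hw : w ∈ φ.target) :
    ContDiffAt ℝ 2 (localRep f φ) w := by
  have h : ContMDiffOn 𝓘(ℝ, ℂ) 𝓘(ℝ, Fin 3 → ℝ) 2 (localRep f φ) φ.target :=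
    hf.comp (contMDiffOn_symm_of_mem_maximalAtlas hφ) φ.symm.mapsTo
  exact (contMDiffOn_iff_contDiffOn.1 h).contDiffAt (φ.open_target.mem_nhds hw)

theorem IsConformalParameter.spinor_ne_zero (hφ : IsConformalParameter f φ) (hw : w ∈ φ.target)
    {a b : ℂ} (hZ : maurerCartan (localRep f φ) w = spinorVec a b) : a ≠ 0 ∨ b ≠ 0 := by
  obtain ⟨-, α, hα⟩ := hφ
  by_contra! h
  have hmetric := (hα w hw).symm.trans (firstForm_eq_of_maurerCartan_eq_spinorVec hZ)
  simpa [h.1, h.2] using congrFun₂ hmetric 0 0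

end Surface

end NilGroup

theorem mainTheorem12_general {M : Type*} [TopologicalSpace M] [ChartedSpace ℂ M]
    [IsManifold 𝓘(ℝ, ℂ) 2 M] (f : M → NilGroup) (φ : OpenPartialHomeomorph M ℂ)
    (hf : ContMDiffOn 𝓘(ℝ, ℂ) 𝓘(ℝ, Fin 3 → ℝ) 2 (fun p => NilGroup.coords (f p)) φ.source)
    (hφ : NilGroup.IsConformalParameter f φ)
    (ψ₁ ψ₂ : ℂ → ℂ) (hψ : NilGroup.IsGeneratingSpinor f φ ψ₁ ψ₂) {w : ℂ} (hw : w ∈ φ.target)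
    {N : Fin 3 → ℝ} (hN : N = (NilGroup.frame (NilGroup.localRep f φ w)).symm
      (NilGroup.spinorNormal (ψ₁ w) (ψ₂ w)))
    {U : ℂ} (hU : U = NilGroup.diracPotential
      (NilGroup.meanCurvature (NilGroup.localRep f φ) w N) (ψ₁ w) (ψ₂ w)) :
    NilGroup.IsUnitNormal (NilGroup.localRep f φ) w N ∧
      DifferentiableAt ℝ ψ₁ w ∧ DifferentiableAt ℝ ψ₂ w ∧
      NilGroup.dzbar ψ₁ w = U * ψ₂ w ∧ NilGroup.dz ψ₂ w = -(U * ψ₁ w) := by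
  have hnhds := φ.open_target.mem_nhds hw
  have hF {ζ : ℂ} (hζ : ζ ∈ φ.target) : ContDiffAt ℝ 2 (NilGroup.localRep f φ) ζ :=
    NilGroup.contDiffAt_localRep hf hφ.1 hζ
  have hZ {ζ : ℂ} (hζ : ζ ∈ φ.target) :=
    hψ.maurerCartan_eq_spinorVec hζ ((hF hζ).differentiableAt two_ne_zero)
  have hne := hφ.spinor_ne_zero hw (hZ hw)
  subst hN
  exact ⟨NilGroup.isUnitNormal_spinorNormal hne (hZ hw),
    NilGroup.dirac_equation (hF hw) (hψ.continuousOn_fst.continuousAt hnhds)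
      (hψ.continuousOn_snd.continuousAt hnhds) hne (Filter.mem_of_superset hnhds fun _ => hZ) hU⟩

theorem mainTheorem12 {M : Type*} [TopologicalSpace M] [ChartedSpace ℂ M]
    [IsManifold 𝓘(ℝ, ℂ) 2 M] (f : M → NilGroup)
    (hf : NilGroup.IsImmersion f) (hmin : NilGroup.IsMinimal f)
    (φ : OpenPartialHomeomorph M ℂ) (hφ : NilGroup.IsConformalParameter f φ)
    (ψ₁ ψ₂ : ℂ → ℂ) (hψ : NilGroup.IsGeneratingSpinor f φ ψ₁ ψ₂) :
    ∀ w ∈ φ.target,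
      DifferentiableAt ℝ ψ₁ w ∧ DifferentiableAt ℝ ψ₂ w ∧
      NilGroup.dzbar ψ₁ w =
        Complex.I / 4 * ((‖ψ₂ w‖ ^ 2 - ‖ψ₁ w‖ ^ 2 : ℝ) : ℂ) * ψ₂ w ∧
      NilGroup.dz ψ₂ w =
        -(Complex.I / 4) * ((‖ψ₂ w‖ ^ 2 - ‖ψ₁ w‖ ^ 2 : ℝ) : ℂ) * ψ₁ w := by
  intro w hw
  have h := mainTheorem12_general f φ hf.contMDiff.contMDiffOn hφ ψ₁ ψ₂ hψ hw rfl rfl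
  simpa [hmin φ hφ.1 w hw _ h.1, NilGroup.diracPotential] using h.2
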